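/- Let $R$ be a ring, and let $\mathcal C=(E,D,i,j,k)$ be a $(\mathbb Z\times\mathbb Z)$-bigraded exact couple of $R$-modules whose structure maps $i:D\to D$, $j:D\to E$, $k:E\to D$ have bidegrees $a,b,c\in\mathbb Z\times\mathbb Z$. Assume that $\mathcal C$ is \emph{regular}, i.e. $\sigma:=\det[a\ \ (b+c)]\in\{1,-1\}$, and fix $n\in\mathbb Z$. Notation: for $m\in\mathbb Z$ let $L^{m}$ be the limit of the diagram of all $D_{y}$ with $\det[a\ \ y]=m$ and the maps $i:D_y\to D_{y+a}$ between them; for such $y$ let $L^{y}:=\ker(L^{m}\to D_{y})$, a stage of the kernel filtration of $L^m$. For $r\ge 0$ let $Z^{r}_{y}:=k^{-1}\bigl(\operatorname{im}(i^{r}:D_{y+c-ra}\to D_{y+c})\bigr)\subseteq E_{y}$ and $Z^{\infty}_y:=\bigcap_r Z^r_y$; these submodules contain $\operatorname{im} j$. The inverse sequences in $r$ of the modules $\ker(i^{r}:D_{y-ra}\to D_{y})$ and of the modules $Z^r_y/\operatorname{im}j$ have transition maps induced by $i$ and by inclusion, respectively. Then there is an exact couple $\mathcal C(1)=(E(1),D(1),i(1),j(1),k(1))$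 of $R$-modules, the \emph{lim-1 exact couple}, whose structure maps again have bidegrees $a,b,c$, so that it is regular, and which has, for every $x$ with $\det[a\ \ x]=n$, the objects $$D(1)_{x}=L^{x+a+b+c}\subseteq L^{n+\sigma},\qquad D(1)_{x+b+c}=\lim\nolimits^{1}_r\ker\bigl(i^{r}:D_{x+b+c-ra}\to D_{x+b+c}\bigr),$$ $$E(1)_{x+b}=Z^{\infty}_{x+b}/\operatorname{im} j,\qquad E(1)_{x+2b+c}=\lim\nolimits^{1}_r\bigl(Z^{r}_{x-a+b}/\operatorname{im} j\bigr),$$ up to isomorphism, while all other objects are $0$. Under these identifications the structure maps are the maps of the $6$-term exact $\lim$-$\lim^1$ sequences $$0\to L^{x+b+c}\to L^{x+a+b+c}\to \frac{Z^{\infty}_{x+b}}{\operatorname{im} j}\to \lim\nolimits^1_r \ker(i^{r})\to\lim\nolimits^1_r\ker(i^{r+1})\to\lim\nolimits^1_r\frac{Z^r_{x+b}}{\operatorname{im} j}\to 0$$ obtained from the short exact sequences of inverse sequences $$0\to\ker(i^r|_{D_{x+b+c-ra}})\to\ker(i^{r+1}|_{D_{x+b+c-ra}})\to Z^r_{x+b}/\operatorname{im}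 j\to 0,$$ in which the second map sends $d$ to the class of any $e$ with $k(e)=i^r(d)$; here $\lim^1_r\ker(i^{r+1}|_{D_{x+b+c-ra}})$ is identified with $\lim^1_r\ker(i^{r}|_{D_{x+a+b+c-ra}})$. -/

import Mathlib

universe u v

/-- The determinant of the `2 × 2` integer matrix with columns `u` and `w`. -/
def bidet (u w : ℤ × ℤ) : ℤ := u.1 * w.2 - u.2 * w.1

theorem bidet_add (u w w' : ℤ × ℤ) : bidet u (w + w') = bidet u w + bidet u w' := by
  simp only [bidet, Prod.fst_add, Prod.snd_add]; ring

theorem bidet_self (u : ℤ × ℤ) : bidet u u = 0 := by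
  simp only [bidet]; ring

/-- A `(ℤ × ℤ)`-bigraded exact couple of left `R`-modules whose structure maps `i : D → D`,
`j : D → E`, `k : E → D` have bidegrees `a`, `b`, `c`.

A map of bidegree `a` has one component out of each `D x`, with codomain `D (x + a)`. To avoid
transports along equalities of indices the codomain is written `D y`, where `y` comes with a
proof of `x + a = y`. -/
structure ExactCouple (R : Type u) [Ring R] (a b c : ℤ × ℤ) where
  D : ℤ × ℤ → Type v
  E : ℤ × ℤ → Type v
  [addCommGroupD : ∀ x, AddCommGroup (D x)]
  [addCommGroupE : ∀ x, AddCommGroup (E x)]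
  [moduleD : ∀ x, Module R (D x)]
  [moduleE : ∀ x, Module R (E x)]
  i : ∀ {x y : ℤ × ℤ}, x + a = y → (D x →ₗ[R] D y)
  j : ∀ {x y : ℤ × ℤ}, x + b = y → (D x →ₗ[R] E y)
  k : ∀ {x y : ℤ × ℤ}, x + c = y → (E x →ₗ[R] D y)
  exact_ij : ∀ {x y z : ℤ × ℤ} (h : x + a = y) (h' : y + b = z), Function.Exact (i h) (j h')
  exact_jk : ∀ {x y z : ℤ × ℤ} (h : x + b = y) (h' : y + c = z), Function.Exact (j h) (k h')
  exact_ki : ∀ {x y z : ℤ × ℤ} (h : x + c = y) (h' : y + a = z), Function.Exact (k h) (i h')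

section Lim1

variable {R : Type u} [Ring R]

/-- For an inverse sequence `⋯ → M 2 → M 1 → M 0` with maps `f r : M (r + 1) → M r`, the map
`∏ M r → ∏ M r`, `(m r) ↦ (m r - f r (m (r + 1)))`, whose kernel is the limit. -/
def limDiff (M : ℕ → Type v) [∀ r, AddCommGroup (M r)] [∀ r, Module R (M r)]
    (f : ∀ r, M (r + 1) →ₗ[R] M r) : (∀ r, M r) →ₗ[R] (∀ r, M r) :=
  LinearMap.pi fun r => LinearMap.proj r - f r ∘ₗ LinearMap.proj (r + 1)

/-- `lim¹` of an inverse sequence of modules: the cokernel of `limDiff`. -/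
abbrev LimOne (M : ℕ → Type v) [∀ r, AddCommGroup (M r)] [∀ r, Module R (M r)]
    (f : ∀ r, M (r + 1) →ₗ[R] M r) : Type v :=
  (∀ r, M r) ⧸ LinearMap.range (limDiff M f)

/-- The class in `lim¹` of a family of elements. -/
abbrev LimOne.mk (M : ℕ → Type v) [∀ r, AddCommGroup (M r)] [∀ r, Module R (M r)]
    (f : ∀ r, M (r + 1) →ₗ[R] M r) (m : ∀ r, M r) : LimOne M f :=
  (LinearMap.range (limDiff M f)).mkQ m

end Lim1

namespace ExactCouple

attribute [instance] addCommGroupD addCommGroupE moduleD moduleE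

variable {R : Type u} [Ring R] {a b c : ℤ × ℤ}

/-- An exact couple is regular if the number `σ = det [a  b + c]` is `1` or `-1`. -/
def IsRegular (_C : ExactCouple.{u, v} R a b c) : Prop :=
  bidet a (b + c) = 1 ∨ bidet a (b + c) = -1

variable (C : ExactCouple.{u, v} R a b c)

/-- The iterate `i ^ r : D x → D (x + r • a)`. -/
def iPow : (r : ℕ) → {x y : ℤ × ℤ} → x + r • a = y → (C.D x →ₗ[R] C.D y)
  | 0, _, _, h => (LinearEquiv.cast (R := R) (M := C.D) (by simpa using h)).toLinearMap
  | r + 1, x, _, h =>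
      iPow r (x := x + a) (by rw [← h, add_smul, one_smul]; abel) ∘ₗ C.i (x := x) rfl

theorem iPow_succ_apply (r : ℕ) {x y z : ℤ × ℤ} (h : x + (r + 1) • a = z) (h₁ : x + a = y)
    (h₂ : y + r • a = z) (d : C.D x) : C.iPow (r + 1) h d = C.iPow r h₂ (C.i h₁ d) := by
  subst h₁; rfl

/-! ### The limit abutment and its kernel filtration -/

/-- The positions `y` of the `m`-th column `⋯ → D (y - a) → D y → D (y + a) → ⋯`. -/
abbrev Column (a : ℤ × ℤ) (m : ℤ) : Type := {y : ℤ × ℤ // bidet a y = m}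

/-- The limit abutment `L^m`: the limit of the `m`-th column of `D`-objects. -/
def limAbutment (m : ℤ) : Submodule R (∀ y : Column a m, C.D y) where
  carrier := {f | ∀ (y z : Column a m) (h : (y : ℤ × ℤ) + a = z), C.i h (f y) = f z}
  add_mem' hf hg y z h := by simp [hf y z h, hg y z h]
  zero_mem' y z h := by simp
  smul_mem' t f hf y z h := by simp [hf y z h]

/-- The cone map `L^m → D y`. -/
def limProj {m : ℤ} (y : Column a m) : C.limAbutment m →ₗ[R] C.D y :=
  LinearMap.proj y ∘ₗ (C.limAbutment m).subtype

/-- The stage `L^y = ker (L^m → D y)` of the kernel filtration of `L^m`. -/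
def limFiltration {m : ℤ} (y : Column a m) : Submodule R (C.limAbutment m) :=
  LinearMap.ker (C.limProj y)

/-! ### The inverse sequence of kernels -/

/-- `ker (i ^ r : D (y - r • a) → D y)`. -/
def kerPow (y : ℤ × ℤ) (r : ℕ) : Submodule R (C.D (y - r • a)) :=
  LinearMap.ker (C.iPow r (sub_add_cancel y (r • a)))

/-- The map `i` restricts to `ker (i ^ (r + 1)) → ker (i ^ r)`. -/
def kerPowMap (y : ℤ × ℤ) (r : ℕ) : C.kerPow y (r + 1) →ₗ[R] C.kerPow y r :=
  (C.i (show y - (r + 1) • a + a = y - r • a by rw [add_smul, one_smul]; abel)).restrict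
    (by
      intro d hd
      have hd' := LinearMap.mem_ker.mp hd
      rw [C.iPow_succ_apply r _ (show y - (r + 1) • a + a = y - r • a by
        rw [add_smul, one_smul]; abel) (sub_add_cancel y (r • a))] at hd'
      exact LinearMap.mem_ker.mpr hd')

/-- `lim¹` over `r` of `ker (i ^ r : D (y - r • a) → D y)`. -/
abbrev LimOneKer (y : ℤ × ℤ) : Type v :=
  LimOne (R := R) (fun r => C.kerPow y r) (C.kerPowMap y)

/-- The class in `lim¹ ker (i ^ r)` of a family of elements of the kernels. -/
def limOneKerMk (y : ℤ × ℤ) (z : ∀ r, C.kerPow y r) : C.LimOneKer y :=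
  LimOne.mk (R := R) (fun r => C.kerPow y r) (C.kerPowMap y) z

/-! ### Cycles -/

/-- The cycles `Z^r = k⁻¹ (im i ^ r)` in `E y`. -/
def cycles (r : ℕ) (y : ℤ × ℤ) : Submodule R (C.E y) :=
  (LinearMap.range (C.iPow r (sub_add_cancel (y + c) (r • a)))).comap (C.k rfl)

/-- `Z^∞`, the intersection of all `Z^r`. -/
def cyclesInf (y : ℤ × ℤ) : Submodule R (C.E y) := ⨅ r, C.cycles r y

theorem cycles_succ_le (r : ℕ) (y : ℤ × ℤ) : C.cycles (r + 1) y ≤ C.cycles r y := by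
  rintro e ⟨d, hd⟩
  rw [C.iPow_succ_apply r _ (show y + c - (r + 1) • a + a = y + c - r • a by
        rw [add_smul, one_smul]; abel) (sub_add_cancel (y + c) (r • a))] at hd
  exact ⟨_, hd⟩

/-- The image of `j` in `E y`. -/
def jRange (y : ℤ × ℤ) : Submodule R (C.E y) := LinearMap.range (C.j (sub_add_cancel y b))

/-- `Z^r / im j` in position `y`; the submodule `im j` is contained in `Z^r`. -/
abbrev CycleQuot (y : ℤ × ℤ) (r : ℕ) : Type v :=
  C.cycles r y ⧸ (C.jRange y).submoduleOf (C.cycles r y)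

/-- `Z^∞ / im j` in position `y`; the submodule `im j` is contained in `Z^∞`. -/
abbrev CycleQuotInf (y : ℤ × ℤ) : Type v :=
  C.cyclesInf y ⧸ (C.jRange y).submoduleOf (C.cyclesInf y)

theorem jRange_le_cyclesInf (y : ℤ × ℤ) : C.jRange y ≤ C.cyclesInf y := by
  rintro _ ⟨d, rfl⟩
  refine (Submodule.mem_iInf _).mpr fun r => ?_
  have h0 : C.k rfl (C.j (sub_add_cancel y b) d) = 0 :=
    (C.exact_jk (sub_add_cancel y b) rfl _).mpr ⟨d, rfl⟩
  exact ⟨0, by rw [map_zero, h0]⟩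

/-- The map `Z^(r + 1) / im j → Z^r / im j` induced by inclusion. -/
def cycleQuotMap (y : ℤ × ℤ) (r : ℕ) : C.CycleQuot y (r + 1) →ₗ[R] C.CycleQuot y r :=
  Submodule.mapQ _ _ (Submodule.inclusion (C.cycles_succ_le r y)) (fun _ he => he)

/-- `lim¹` over `r` of `Z^r / im j` in position `y`. -/
abbrev LimOneCycleQuot (y : ℤ × ℤ) : Type v :=
  LimOne (R := R) (C.CycleQuot y) (C.cycleQuotMap y)

/-- The class in `lim¹ (Z^r / im j)` of a family of cycles. -/
def limOneCycleMk (y : ℤ × ℤ) (e : ∀ r, C.cycles r y) : C.LimOneCycleQuot y :=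
  LimOne.mk (R := R) (C.CycleQuot y) (C.cycleQuotMap y) fun r => Submodule.Quotient.mk (e r)

/-! ### The lim-1 exact couple -/

theorem column_add {n : ℤ} {x : ℤ × ℤ} (hx : bidet a x = n) : bidet a (x + a) = n := by
  rw [bidet_add, bidet_self, hx, add_zero]

theorem column_next {n : ℤ} {x : ℤ × ℤ} (b c : ℤ × ℤ) (hx : bidet a x = n) :
    bidet a (x + b + c) = n + bidet a (b + c) := by
  rw [add_assoc, bidet_add, hx]

/-- The data exhibiting `C'` as the lim-1 exact couple of `C` in position `n`. With
`σ = det [a  b + c]`, in the `n`-th column, i.e. for `det [a  x] = n`,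
* `D' x = L^(x + a + b + c)`, a stage of the kernel filtration of `L^(n + σ)`;
* `D' (x + b + c) = lim¹ ker (i ^ r : D (x + b + c - r • a) → D (x + b + c))`;
* `E' (x + b) = Z^∞ / im j` in position `x + b`;
* `E' (x + 2b + c) = lim¹ (Z^r / im j)` in position `x - a + b`;

all other objects are zero, and the structure maps are the maps of the six-term
`lim`-`lim¹` sequences
`L^(x+b+c) → L^(x+a+b+c) → Z^∞_(x+b) / im j → lim¹ ker i ^ r → lim¹ ker i ^ (r + 1)
→ lim¹ (Z^r_(x+b) / im j)` of the short exact sequences of inverse sequences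
`ker (i ^ r) → ker (i ^ (r + 1)) → Z^r_(x+b) / im j` on `D (x + b + c - r • a)`, in which the
second map sends `d` to the class of those `e` with `k e = i ^ r d`. -/
structure LimOneCouple (n : ℤ) (C' : ExactCouple.{u, v} R a b c) where
  /-- `D' x = L^(x + a + b + c)` -/
  isoD : ∀ {x : ℤ × ℤ} (hx : bidet a x = n),
    C'.D x ≃ₗ[R] C.limFiltration (⟨x + a + b + c, column_next b c (column_add hx)⟩ :
      Column a (n + bidet a (b + c)))
  /-- `D' (x + b + c) = lim¹ ker (i ^ r)` -/
  isoD₁ : ∀ {x : ℤ × ℤ}, bidet a x = n → (C'.D (x + b + c) ≃ₗ[R] C.LimOneKer (x + b + c))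
  /-- `E' (x + b) = Z^∞ / im j` -/
  isoE : ∀ {x : ℤ × ℤ}, bidet a x = n → (C'.E (x + b) ≃ₗ[R] C.CycleQuotInf (x + b))
  /-- `E' (x + 2b + c) = lim¹ (Z^r / im j)` -/
  isoE₁ : ∀ {x : ℤ × ℤ}, bidet a x = n →
    (C'.E (x + 2 • b + c) ≃ₗ[R] C.LimOneCycleQuot (x - a + b))
  /-- All other `D'`-objects are zero. -/
  zeroD : ∀ y : ℤ × ℤ, bidet a y ≠ n → bidet a y ≠ n + bidet a (b + c) → Subsingleton (C'.D y)
  /-- All other `E'`-objects are zero. -/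
  zeroE : ∀ y : ℤ × ℤ, bidet a y ≠ n → bidet a y ≠ n + bidet a (b + c) →
    Subsingleton (C'.E (y + b))
  /-- `i' : D' x → D' (x + a)` is the inclusion of filtration stages of `L^(n + σ)`. -/
  map_i : ∀ {x : ℤ × ℤ} (hx : bidet a x = n) (d : C'.D x),
    (isoD (column_add hx) (C'.i rfl d) : C.limAbutment (n + bidet a (b + c))) =
      (isoD hx d : C.limAbutment (n + bidet a (b + c)))
  /-- `j' : D' x → E' (x + b)` sends a family `f` in `L^(x + a + b + c)` to the class of those
  `e` for which `k e` is the component of `f` in `D (x + b + c)`. -/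
  map_j : ∀ {x : ℤ × ℤ} (hx : bidet a x = n) (d : C'.D x) (e : C.cyclesInf (x + b)),
    C.k rfl (e : C.E (x + b)) =
      C.limProj (⟨x + b + c, column_next b c hx⟩ : Column a (n + bidet a (b + c)))
        (isoD hx d : C.limAbutment (n + bidet a (b + c))) →
    isoE hx (C'.j rfl d) = Submodule.Quotient.mk e
  /-- `k' : E' (x + b) → D' (x + b + c)` is the connecting map: if `i ^ r (w r) = k e` for all
  `r`, then the class of `e` goes to the class of the family `w r - i (w (r + 1))`. -/
  map_k : ∀ {x : ℤ × ℤ} (hx : bidet a x = n) (e : C.cyclesInf (x + b))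
    (w : ∀ r : ℕ, C.D (x + b + c - r • a)) (z : ∀ r : ℕ, C.kerPow (x + b + c) r),
    (∀ r, C.iPow r (sub_add_cancel (x + b + c) (r • a)) (w r) = C.k rfl (e : C.E (x + b))) →
    (∀ r, (z r : C.D (x + b + c - r • a)) = w r -
      C.i (show x + b + c - (r + 1) • a + a = x + b + c - r • a by
        rw [add_smul, one_smul]; abel) (w (r + 1))) →
    isoD₁ hx (C'.k rfl ((isoE hx).symm (Submodule.Quotient.mk e))) =
      C.limOneKerMk (x + b + c) z
  /-- `i' : D' (x + b + c) → D' (x + a + b + c)` is induced by the inclusions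
  `ker (i ^ r) ⊆ ker (i ^ (r + 1))` in `D (x + b + c - r • a) = D (x + a + b + c - (r + 1) • a)`. -/
  map_i₁ : ∀ {x : ℤ × ℤ} (hx : bidet a x = n) (z : ∀ r : ℕ, C.kerPow (x + b + c) r)
    (z' : ∀ r : ℕ, C.kerPow (x + a + b + c) r),
    (∀ r, (z' (r + 1) : C.D (x + a + b + c - (r + 1) • a)) =
      LinearEquiv.cast (R := R) (M := C.D)
        (show x + b + c - r • a = x + a + b + c - (r + 1) • a by
          rw [add_smul, one_smul]; abel) (z r : C.D (x + b + c - r • a))) →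
    isoD₁ (column_add hx) (C'.i (show x + b + c + a = x + a + b + c by abel)
        ((isoD₁ hx).symm (C.limOneKerMk (x + b + c) z))) =
      C.limOneKerMk (x + a + b + c) z'
  /-- `j' : D' (x + b + c) → E' (x + 2b + c)` is induced by the maps
  `ker (i ^ (r + 1)) → Z^r / im j`, `d ↦ [e]` with `k e = i ^ r d`. -/
  map_j₁ : ∀ {x : ℤ × ℤ} (hx : bidet a x = n) (z : ∀ r : ℕ, C.kerPow (x + b + c) r)
    (e : ∀ r : ℕ, C.cycles r (x - a + b)),
    (∀ r, C.k rfl (e r : C.E (x - a + b)) =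
      C.iPow r (show x + b + c - (r + 1) • a + r • a = x - a + b + c by
        rw [add_smul, one_smul]; abel) (z (r + 1) : C.D (x + b + c - (r + 1) • a))) →
    isoE₁ hx (C'.j (show x + b + c + b = x + 2 • b + c by rw [two_smul]; abel)
        ((isoD₁ hx).symm (C.limOneKerMk (x + b + c) z))) =
      C.limOneCycleMk (x - a + b) e

end ExactCouple

/-! The theorem is a snake lemma followed by bookkeeping of columns. Fix `q + c = p` and `p + a =
p'`. The products of `ker (i ^ r)` at `p`, of `ker (i ^ r)` at `p'` and of `Z^r / im j` at `q` form
a short exact sequence (`kerShiftPi`, `kerToCyclePi`), on which `limDiff` acts compatibly. Its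
cokernels are the `lim¹` terms, so `exists_connecting` and `exact_mapQ_range` give the six-term
sequence once the kernels are known. The kernel of `limDiff` is `Z^∞ / im j` at `q`
(`exact_cycleQuotInfToPi`) and is the image of `L^p'` at `p'` (`exact_filtrationToPi`, by extending
a compatible family by zero). The start of the sequence, at `L^p → L^p'`, is checked directly in
`exact_filtrationIncl`.

Two devices keep this manageable. Since `ker (i ^ 0) = 0`, the product of the `ker (i ^ (r + 1))` is
the product of the `ker (i ^ r)` with a zero factor added, so the reindexing of `lim¹` becomes a
shift of components. And `k` embeds every subquotient `S / im j` of `E` into `D`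
(`quotK_injective`), so identities between classes are verified in `D`.

For the couple, the six-term sequences are spliced: `i` and `j` preserve the two columns `n` and `n
+ σ`, while `k` is the connecting map from the first to the second. Regularity gives `σ ≠ 0`, which
separates the columns and forces `a ≠ 0`. -/

section LinearAlgebra

variable {R : Type u} [Ring R]

/-- A linear map whose values lie in the range of an injective linear map factors through it. -/
noncomputable def liftInjective {M N P : Type*} [AddCommGroup M] [AddCommGroup N] [AddCommGroup P]
    [Module R M] [Module R N] [Module R P] (f : N →ₗ[R] P) (hf : Function.Injective f)
    (g : M →ₗ[R] P) (hg : ∀ m, g m ∈ LinearMap.range f) : M →ₗ[R] N :=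
  (LinearEquiv.ofInjective f hf).symm.toLinearMap ∘ₗ g.codRestrict _ hg

theorem apply_liftInjective {M N P : Type*} [AddCommGroup M] [AddCommGroup N] [AddCommGroup P]
    [Module R M] [Module R N] [Module R P] (f : N →ₗ[R] P) (hf : Function.Injective f)
    (g : M →ₗ[R] P) (hg : ∀ m, g m ∈ LinearMap.range f) (m : M) :
    f (liftInjective f hf g hg m) = g m := by
  have := LinearEquiv.apply_symm_apply (LinearEquiv.ofInjective f hf) (g.codRestrict _ hg m)
  exact congrArg Subtype.val this

/-! ### Snake lemma for an endomorphism of a short exact sequence -/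

section Snake

variable {M₁ M₂ M₃ K₂ K₃ : Type*} [AddCommGroup M₁] [AddCommGroup M₂] [AddCommGroup M₃]
  [AddCommMonoid K₂] [AddCommMonoid K₃] [Module R M₁] [Module R M₂] [Module R M₃]
  [Module R K₂] [Module R K₃]
  {d₁ : M₁ →ₗ[R] M₁} {d₂ : M₂ →ₗ[R] M₂} {d₃ : M₃ →ₗ[R] M₃} {f₁ : M₁ →ₗ[R] M₂} {f₂ : M₂ →ₗ[R] M₃}

theorem range_le_comap_range (h₁ : ∀ m, f₁ (d₁ m) = d₂ (f₁ m)) :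
    LinearMap.range d₁ ≤ (LinearMap.range d₂).comap f₁ := by
  rintro _ ⟨m, rfl⟩
  exact ⟨f₁ m, (h₁ m).symm⟩

/-- Right exactness of cokernels: a boundary downstairs lifts through the surjection `f₂`, and
subtracting the lifted boundary leaves an element of the image of `f₁`. -/
theorem exact_mapQ_range (hf : Function.Exact f₁ f₂) (hf₂ : Function.Surjective f₂)
    (h₁ : ∀ m, f₁ (d₁ m) = d₂ (f₁ m)) (h₂ : ∀ m, f₂ (d₂ m) = d₃ (f₂ m)) :
    Function.Exact
      (Submodule.mapQ (LinearMap.range d₁) (LinearMap.range d₂) f₁ (range_le_comap_range h₁))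
      (Submodule.mapQ (LinearMap.range d₂) (LinearMap.range d₃) f₂ (range_le_comap_range h₂)) := by
  intro y
  obtain ⟨y, rfl⟩ := Submodule.mkQ_surjective _ y
  constructor
  · intro h
    obtain ⟨m, hm⟩ := (Submodule.Quotient.mk_eq_zero _).mp h
    obtain ⟨m, rfl⟩ := hf₂ m
    obtain ⟨x, hx⟩ := (hf (y - d₂ m)).mp (by rw [map_sub, h₂, hm, sub_self])
    refine ⟨Submodule.Quotient.mk x, ?_⟩
    rw [Submodule.mapQ_apply, hx]
    exact (Submodule.Quotient.eq _).mpr ⟨-m, by rw [map_neg]; abel⟩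
  · rintro ⟨x, hx⟩
    obtain ⟨x, rfl⟩ := Submodule.mkQ_surjective _ x
    rw [← hx]
    simp [hf.apply_apply_eq_zero]

/-- The connecting homomorphism of the snake lemma over a not necessarily commutative ring, for
endomorphisms `d₁`, `d₂`, `d₃` of the terms of a short exact sequence. -/
theorem exists_connecting (hf₁ : Function.Injective f₁) (hf : Function.Exact f₁ f₂)
    (hf₂ : Function.Surjective f₂)
    (h₁ : ∀ m, f₁ (d₁ m) = d₂ (f₁ m)) (h₂ : ∀ m, f₂ (d₂ m) = d₃ (f₂ m))
    {s₂ : K₂ →ₗ[R] M₂} (hs₂ : Function.Exact s₂ d₂) {s₃ : K₃ →ₗ[R] M₃}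
    (hs₃ : Function.Exact s₃ d₃) (inj₃ : Function.Injective s₃)
    {F : K₂ →ₗ[R] K₃} (hF : ∀ x, f₂ (s₂ x) = s₃ (F x)) :
    ∃ δ : K₃ →ₗ[R] M₁ ⧸ LinearMap.range d₁,
      (∀ x y z, f₂ y = s₃ x → f₁ z = d₂ y → δ x = (LinearMap.range d₁).mkQ z) ∧
      Function.Exact F δ ∧ Function.Exact δ
        (Submodule.mapQ (LinearMap.range d₁) (LinearMap.range d₂) f₁ (range_le_comap_range h₁)) := by
  -- No injectivity of `s₂` is required: it is enough that `K₂` maps onto the kernel of `d₂`.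
  have ex : ∀ x : K₃, ∃ (y : M₂) (z : M₁), f₂ y = s₃ x ∧ f₁ z = d₂ y := by
    intro x
    obtain ⟨y, hy⟩ := hf₂ (s₃ x)
    obtain ⟨z, hz⟩ := (hf (d₂ y)).mp (by rw [h₂, hy, hs₃.apply_apply_eq_zero])
    exact ⟨y, z, hy, hz⟩
  have uniq : ∀ y z, f₂ y = 0 → f₁ z = d₂ y → z ∈ LinearMap.range d₁ := by
    intro y z hy hz
    obtain ⟨m, rfl⟩ := (hf y).mp hy
    exact ⟨m, hf₁ (by rw [h₁, hz])⟩
  choose Y Z hY hZ using ex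
  have key : ∀ x y z, f₂ y = s₃ x → f₁ z = d₂ y →
      (LinearMap.range d₁).mkQ (Z x) = (LinearMap.range d₁).mkQ z := fun x y z hy hz =>
    (Submodule.Quotient.eq _).mpr (uniq (Y x - y) _ (by rw [map_sub, hY, hy, sub_self])
      (by rw [map_sub, map_sub, hZ, hz]))
  -- The chosen lifts are not linear, but `key` allows any other lift to be used, in particular sums
  -- and multiples of chosen ones.
  let δ : K₃ →ₗ[R] M₁ ⧸ LinearMap.range d₁ :=
    { toFun := fun x => (LinearMap.range d₁).mkQ (Z x)
      map_add' := fun x x' => by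
        rw [← map_add]
        exact key _ (Y x + Y x') _ (by simp only [map_add, hY]) (by simp only [map_add, hZ])
      map_smul' := fun t x => by
        rw [RingHom.id_apply, ← map_smul]
        exact key _ (t • Y x) _ (by simp only [map_smul, hY]) (by simp only [map_smul, hZ]) }
  refine ⟨δ, key, fun x => ⟨fun hx => ?_, ?_⟩, fun z => ?_⟩
  · obtain ⟨m, hm⟩ := (Submodule.Quotient.mk_eq_zero _).mp hx
    obtain ⟨w, hw⟩ := (hs₂ (Y x - f₁ m)).mp (by rw [map_sub, ← h₁, hm, hZ, sub_self])
    exact ⟨w, inj₃ (by rw [← hF, hw, map_sub, hY, hf.apply_apply_eq_zero, sub_zero])⟩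
  · rintro ⟨w, rfl⟩
    exact (key _ (s₂ w) 0 (hF w) (by rw [map_zero, hs₂.apply_apply_eq_zero])).trans (map_zero _)
  · obtain ⟨z, rfl⟩ := Submodule.mkQ_surjective _ z
    constructor
    · intro h
      obtain ⟨y, hy⟩ := (Submodule.Quotient.mk_eq_zero _).mp h
      obtain ⟨x, hx⟩ := (hs₃ (f₂ y)).mp (by rw [← h₂, hy, hf.apply_apply_eq_zero])
      exact ⟨x, key x y z hx.symm hy.symm⟩
    · rintro ⟨x, hx⟩
      rw [← hx]
      refine (Submodule.Quotient.mk_eq_zero _).mpr ⟨Y x, (hZ x).symm⟩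

end Snake

/-! ### Modules present only when a proposition holds -/

section PropIndexed

variable {P Q S : Prop}

/-- The map between products over truth values induced by componentwise maps. -/
def propMap {M : PLift P → Type v} {N : PLift Q → Type v} [∀ h, AddCommMonoid (M h)]
    [∀ h, AddCommMonoid (N h)] [∀ h, Module R (M h)] [∀ h, Module R (N h)] (g : Q → P)
    (f : ∀ h : PLift Q, M ⟨g h.down⟩ →ₗ[R] N h) : (∀ h, M h) →ₗ[R] (∀ h, N h) :=
  LinearMap.pi fun h => f h ∘ₗ LinearMap.proj (φ := M) ⟨g h.down⟩

theorem propMap_injective {M : PLift P → Type v} {N : PLift Q → Type v}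
    [∀ h, AddCommMonoid (M h)] [∀ h, AddCommMonoid (N h)] [∀ h, Module R (M h)]
    [∀ h, Module R (N h)] (g : Q → P) (g' : P → Q)
    {f : ∀ h : PLift Q, M ⟨g h.down⟩ →ₗ[R] N h} (hf : ∀ h, Function.Injective (f h)) :
    Function.Injective (propMap g f) :=
  fun _ _ hxy => funext fun p => hf ⟨g' p.down⟩ (congrFun hxy ⟨g' p.down⟩)

theorem propMap_surjective {M : PLift P → Type v} {N : PLift Q → Type v}
    [∀ h, AddCommMonoid (M h)] [∀ h, AddCommMonoid (N h)] [∀ h, Module R (M h)]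
    [∀ h, Module R (N h)] (g : Q → P) (g' : P → Q)
    {f : ∀ h : PLift Q, M ⟨g h.down⟩ →ₗ[R] N h} (hf : ∀ h, Function.Surjective (f h)) :
    Function.Surjective (propMap g f) := by
  intro y
  choose x hx using fun h => hf h (y h)
  exact ⟨fun p => x ⟨g' p.down⟩, funext hx⟩

/-- The index propositions are equivalent, so the sequence is either the given one or consists of
zero modules; a componentwise argument covers both cases without deciding which holds. -/
theorem propMap_exact {M : PLift P → Type v} {N : PLift Q → Type v} {L : PLift S → Type v}
    [∀ h, AddCommMonoid (M h)] [∀ h, AddCommMonoid (N h)] [∀ h, AddCommMonoid (L h)]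
    [∀ h, Module R (M h)] [∀ h, Module R (N h)] [∀ h, Module R (L h)]
    (g : Q → P) (g' : P → Q) (l : S → Q) (l' : Q → S)
    {f : ∀ h : PLift Q, M ⟨g h.down⟩ →ₗ[R] N h} {f' : ∀ h : PLift S, N ⟨l h.down⟩ →ₗ[R] L h}
    (hf : ∀ h : PLift S, Function.Exact (f ⟨l h.down⟩) (f' h)) :
    Function.Exact (propMap g f) (propMap l f') := by
  intro y
  constructor
  · intro hy
    choose x hx using fun h : PLift Q =>
      (hf ⟨l' h.down⟩ (y h)).mp (congrFun hy ⟨l' h.down⟩)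
    exact ⟨fun p => x ⟨g' p.down⟩, funext hx⟩
  · rintro ⟨x, rfl⟩
    exact funext fun h => (hf h _).mpr ⟨_, rfl⟩

/-- A product over a true and a false proposition. -/
def propProdLeft (M : PLift P → Type v) (N : PLift Q → Type v) [∀ h, AddCommMonoid (M h)]
    [∀ h, AddCommMonoid (N h)] [∀ h, Module R (M h)] [∀ h, Module R (N h)] (hp : P) (hq : ¬ Q) :
    ((∀ h, M h) × (∀ h, N h)) ≃ₗ[R] M ⟨hp⟩ where
  toFun f := f.1 ⟨hp⟩
  invFun m := (fun _ => m, 0)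
  map_add' _ _ := rfl
  map_smul' _ _ := rfl
  left_inv _ := Prod.ext rfl (funext fun h => absurd h.down hq)
  right_inv _ := rfl

/-- A product over a false and a true proposition. -/
def propProdRight (M : PLift P → Type v) (N : PLift Q → Type v) [∀ h, AddCommMonoid (M h)]
    [∀ h, AddCommMonoid (N h)] [∀ h, Module R (M h)] [∀ h, Module R (N h)] (hp : ¬ P) (hq : Q) :
    ((∀ h, M h) × (∀ h, N h)) ≃ₗ[R] N ⟨hq⟩ where
  toFun f := f.2 ⟨hq⟩
  invFun m := (0, fun _ => m)
  map_add' _ _ := rfl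
  map_smul' _ _ := rfl
  left_inv _ := Prod.ext (funext fun h => absurd h.down hp) rfl
  right_inv _ := rfl

theorem subsingleton_propProd (M : PLift P → Type v) (N : PLift Q → Type v) (hp : ¬ P)
    (hq : ¬ Q) : Subsingleton ((∀ h, M h) × (∀ h, N h)) :=
  ⟨fun _ _ => Prod.ext (funext fun h => absurd h.down hp) (funext fun h => absurd h.down hq)⟩

end PropIndexed

end LinearAlgebra

namespace ExactCouple

variable {R : Type u} [Ring R] {a b c : ℤ × ℤ} (C : ExactCouple.{u, v} R a b c)

/-! ### Transport of `i` and its iterates -/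

theorem i_cast {x x' y y' : ℤ × ℤ} (hx : x = x') (hy : y = y') (h : x + a = y) (h' : x' + a = y')
    (d : C.D x) :
    C.i h' (LinearEquiv.cast (R := R) (M := C.D) hx d) =
      LinearEquiv.cast (R := R) (M := C.D) hy (C.i h d) := by
  subst hx hy; rfl

theorem iPow_cast (r : ℕ) {x x' y : ℤ × ℤ} (hx : x = x') (h : x + r • a = y)
    (h' : x' + r • a = y) (d : C.D x) :
    C.iPow r h' (LinearEquiv.cast (R := R) (M := C.D) hx d) = C.iPow r h d := by
  subst hx; rfl

/-- The recursion for `iPow` splits off the first factor `i`; here the last one is split off. -/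
theorem i_iPow (r : ℕ) {x y z : ℤ × ℤ} (h : x + r • a = y) (h' : y + a = z)
    (h'' : x + (r + 1) • a = z) (d : C.D x) :
    C.i h' (C.iPow r h d) = C.iPow (r + 1) h'' d := by
  induction r generalizing x with
  | zero =>
    obtain rfl : x = y := by simpa using h
    subst h'
    rfl
  | succ r ih =>
    have h₁ : (x + a) + r • a = y := by rw [← h, add_smul, one_smul]; abel
    have h₂ : (x + a) + (r + 1) • a = z := by
      rw [← h'', add_smul (r + 1) 1 a, one_smul, add_assoc, add_comm a]
    rw [C.iPow_succ_apply r h rfl h₁, C.iPow_succ_apply (r + 1) h'' rfl h₂, ih h₁ h₂]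

theorem iPow_zero_eq_zero {x y : ℤ × ℤ} (h : x + 0 • a = y) {d : C.D x}
    (hd : C.iPow 0 h d = 0) : d = 0 := by
  obtain rfl : x = y := by simpa using h
  exact hd

instance subsingleton_kerPow_zero (y : ℤ × ℤ) : Subsingleton (C.kerPow y 0) :=
  subsingleton_of_forall_eq 0 fun d =>
    Subtype.ext (C.iPow_zero_eq_zero _ (LinearMap.mem_ker.mp d.2))

/-! ### Quotients of submodules of `E` by the image of `j` -/

theorem jRange_eq_ker (y : ℤ × ℤ) : C.jRange y = LinearMap.ker (C.k (rfl : y + c = y + c)) :=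
  ((C.exact_jk (sub_add_cancel y b) rfl).linearMap_ker_eq).symm

/-- The map induced by `k` on the quotient by `im j` of a submodule of `E y`. -/
def quotK {y : ℤ × ℤ} (S : Submodule R (C.E y)) :
    (S ⧸ (C.jRange y).submoduleOf S) →ₗ[R] C.D (y + c) :=
  Submodule.liftQ _ (C.k rfl ∘ₗ S.subtype) (by
    intro e he
    have he' : (e : C.E y) ∈ C.jRange y := he
    rwa [jRange_eq_ker] at he')

theorem quotK_mk {y : ℤ × ℤ} (S : Submodule R (C.E y)) (e : S) :
    C.quotK S (Submodule.Quotient.mk e) = C.k rfl (e : C.E y) := rfl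

/-- Exactness at `E` makes `im j` the kernel of `k`. -/
theorem quotK_injective {y : ℤ × ℤ} (S : Submodule R (C.E y)) :
    Function.Injective (C.quotK S) := by
  rw [injective_iff_map_eq_zero]
  intro e he
  obtain ⟨e, rfl⟩ := Submodule.Quotient.mk_surjective _ e
  refine (Submodule.Quotient.mk_eq_zero _).mpr ?_
  change (e : C.E y) ∈ C.jRange y
  rw [jRange_eq_ker]
  exact he

theorem mem_range_quotK {y : ℤ × ℤ} (S : Submodule R (C.E y)) (e : C.E y) (he : e ∈ S) :
    C.k rfl e ∈ LinearMap.range (C.quotK S) :=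
  ⟨Submodule.Quotient.mk ⟨e, he⟩, rfl⟩

theorem quotK_cycleQuotMap (y : ℤ × ℤ) (r : ℕ) (e : C.CycleQuot y (r + 1)) :
    C.quotK _ (C.cycleQuotMap y r e) = C.quotK _ e := by
  obtain ⟨e, rfl⟩ := Submodule.Quotient.mk_surjective _ e
  rfl

/-- The inclusion of `Z^∞ / im j` into `∏ Z^r / im j`. -/
def cycleQuotInfToPi (y : ℤ × ℤ) : C.CycleQuotInf y →ₗ[R] ∀ r, C.CycleQuot y r :=
  LinearMap.pi fun r => Submodule.mapQ _ _
    (Submodule.inclusion (iInf_le (fun r => C.cycles r y) r)) (fun _ he => he)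

theorem quotK_cycleQuotInfToPi (y : ℤ × ℤ) (e : C.CycleQuotInf y) (r : ℕ) :
    C.quotK _ (C.cycleQuotInfToPi y e r) = C.quotK _ e := by
  obtain ⟨e, rfl⟩ := Submodule.Quotient.mk_surjective _ e
  rfl

theorem cycleQuotInfToPi_injective (y : ℤ × ℤ) :
    Function.Injective (C.cycleQuotInfToPi y) := by
  intro e e' h
  refine C.quotK_injective _ ?_
  rw [← C.quotK_cycleQuotInfToPi y e 0, h, C.quotK_cycleQuotInfToPi]

/-- The transition maps preserve values of `k`, so all components of a compatible family have the
same value. Membership in `Z^r` depends only on that value, hence a representative of component `0`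
lies in every `Z^r`. -/
theorem exact_cycleQuotInfToPi (y : ℤ × ℤ) :
    Function.Exact (C.cycleQuotInfToPi y) (limDiff (C.CycleQuot y) (C.cycleQuotMap y)) := by
  intro m
  constructor
  · intro h
    have hm : ∀ r, C.quotK _ (m r) = C.quotK _ (m 0) := by
      intro r
      induction r with
      | zero => rfl
      | succ r ih =>
        have hr : m r = C.cycleQuotMap y r (m (r + 1)) := sub_eq_zero.mp (congrFun h r)
        rw [← ih, hr, quotK_cycleQuotMap]
    obtain ⟨e, he⟩ := Submodule.Quotient.mk_surjective _ (m 0)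
    have hk : ∀ r, C.quotK _ (m r) = C.k rfl (e : C.E y) := fun r => by
      rw [hm, ← he, quotK_mk]
    have mem : (e : C.E y) ∈ C.cyclesInf y := by
      refine (Submodule.mem_iInf _).mpr fun r => ?_
      obtain ⟨e', he'⟩ := Submodule.Quotient.mk_surjective _ (m r)
      have h' : C.k rfl (e' : C.E y) = C.k rfl (e : C.E y) := by
        rw [← hk r, ← he', quotK_mk]
      have hr : C.k rfl (e' : C.E y) ∈ LinearMap.range _ := e'.2
      rw [h'] at hr
      exact hr
    refine ⟨Submodule.Quotient.mk ⟨e, mem⟩, funext fun r => C.quotK_injective _ ?_⟩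
    rw [quotK_cycleQuotInfToPi, quotK_mk, hk]
  · rintro ⟨e, rfl⟩
    refine funext fun r => sub_eq_zero.mpr (C.quotK_injective _ ?_)
    refine (C.quotK_cycleQuotInfToPi y e r).trans (Eq.trans ?_ (C.quotK_cycleQuotMap y r _).symm)
    exact (C.quotK_cycleQuotInfToPi y e (r + 1)).symm

/-! ### The short exact sequences of inverse sequences -/

theorem sub_smul_shift {p p' : ℤ × ℤ} (h : p + a = p') (r : ℕ) :
    p - r • a = p' - (r + 1) • a := by
  rw [← h, add_smul, one_smul]; abel

/-- The inclusion `ker (i ^ r) → ker (i ^ (r + 1))` of submodules of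
`D (p - r • a) = D (p + a - (r + 1) • a)`. -/
def kerShift {p p' : ℤ × ℤ} (h : p + a = p') (r : ℕ) : C.kerPow p r →ₗ[R] C.kerPow p' (r + 1) :=
  (LinearEquiv.cast (R := R) (M := C.D) (sub_smul_shift h r)).toLinearMap.restrict (by
    intro d hd
    refine LinearMap.mem_ker.mpr ?_
    have e : p - r • a + (r + 1) • a = p' := by rw [← h, add_smul, one_smul]; abel
    have := LinearMap.mem_ker.mp hd
    rw [LinearEquiv.coe_coe, C.iPow_cast (r + 1) (sub_smul_shift h r) e,
      ← C.i_iPow r (sub_add_cancel p (r • a)) h e, this, map_zero])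

/-- The map `∏ ker (i ^ r) → ∏ ker (i ^ r)` that shifts by the inclusions, with zeroth component
zero. -/
def kerShiftPi {p p' : ℤ × ℤ} (h : p + a = p') :
    (∀ r, C.kerPow p r) →ₗ[R] (∀ r, C.kerPow p' r) :=
  LinearMap.pi fun
    | 0 => 0
    | r + 1 => C.kerShift h r ∘ₗ LinearMap.proj r

theorem sub_smul_add_smul {q p' : ℤ × ℤ} (h : q + c + a = p') (r : ℕ) :
    p' - (r + 1) • a + r • a = q + c := by
  rw [← h, add_smul, one_smul]; abel

/-- As `i (i ^ r d) = 0`, exactness at `D` writes `i ^ r d` as `k e`, and this equation itself shows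
`e ∈ Z^r`. -/
theorem iPow_mem_range_quotK {q p' : ℤ × ℤ} (h : q + c + a = p') (r : ℕ)
    (d : C.kerPow p' (r + 1)) :
    C.iPow r (sub_smul_add_smul h r) (d : C.D (p' - (r + 1) • a)) ∈
      LinearMap.range (C.quotK (C.cycles r q)) := by
  have hd : C.i h (C.iPow r (sub_smul_add_smul h r) (d : C.D (p' - (r + 1) • a))) = 0 := by
    rw [C.i_iPow r _ h (sub_add_cancel p' _)]
    exact LinearMap.mem_ker.mp d.2
  obtain ⟨e, he⟩ := (C.exact_ki rfl h _).mp hd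
  rw [← he]
  refine C.mem_range_quotK _ e ?_
  refine ⟨LinearEquiv.cast (R := R) (M := C.D) (sub_smul_shift h r).symm d, ?_⟩
  rw [he, C.iPow_cast]

/-- The map `ker (i ^ (r + 1)) → Z^r / im j` with `d ↦ [e]` for `k e = i ^ r d`. -/
noncomputable def kerToCycle {q p' : ℤ × ℤ} (h : q + c + a = p') (r : ℕ) :
    C.kerPow p' (r + 1) →ₗ[R] C.CycleQuot q r :=
  liftInjective (C.quotK (C.cycles r q)) (C.quotK_injective _)
    (C.iPow r (sub_smul_add_smul h r) ∘ₗ (C.kerPow p' (r + 1)).subtype)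
    (C.iPow_mem_range_quotK h r)

theorem quotK_kerToCycle {q p' : ℤ × ℤ} (h : q + c + a = p') (r : ℕ)
    (d : C.kerPow p' (r + 1)) :
    C.quotK _ (C.kerToCycle h r d) =
      C.iPow r (sub_smul_add_smul h r) (d : C.D (p' - (r + 1) • a)) :=
  apply_liftInjective _ _ _ _ d

/-- The product of the maps `ker (i ^ (r + 1)) → Z^r / im j`. -/
noncomputable def kerToCyclePi {q p' : ℤ × ℤ} (h : q + c + a = p') :
    (∀ r, C.kerPow p' r) →ₗ[R] (∀ r, C.CycleQuot q r) :=
  LinearMap.pi fun r => C.kerToCycle h r ∘ₗ LinearMap.proj (r + 1)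

theorem kerShiftPi_injective {p p' : ℤ × ℤ} (h : p + a = p') :
    Function.Injective (C.kerShiftPi h) := by
  intro z z' hz
  refine funext fun r => Subtype.ext ?_
  exact (LinearEquiv.cast (R := R) (M := C.D) (sub_smul_shift h r)).injective
    (congrArg Subtype.val (congrFun hz (r + 1)))

theorem kerToCyclePi_surjective {q p' : ℤ × ℤ} (h : q + c + a = p') :
    Function.Surjective (C.kerToCyclePi h) := by
  have : ∀ r, Function.Surjective (C.kerToCycle h r) := by
    intro r e
    obtain ⟨e, rfl⟩ := Submodule.Quotient.mk_surjective _ e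
    obtain ⟨d, hd⟩ := e.2
    have hd' : C.iPow r (sub_smul_add_smul h r)
        (LinearEquiv.cast (R := R) (M := C.D) (sub_smul_shift h r) d) = C.k rfl (e : C.E q) := by
      rw [C.iPow_cast r (sub_smul_shift h r) (sub_add_cancel (q + c) _), hd]
    refine ⟨⟨LinearEquiv.cast (R := R) (M := C.D) (sub_smul_shift h r) d, ?_⟩, ?_⟩
    · refine LinearMap.mem_ker.mpr ?_
      rw [← C.i_iPow r (sub_smul_add_smul h r) h, hd', (C.exact_ki rfl h).apply_apply_eq_zero]
    · refine C.quotK_injective _ ?_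
      rw [quotK_kerToCycle, quotK_mk, hd']
  intro m
  choose z hz using fun r => this r (m r)
  -- Component `0` does not enter `kerToCyclePi`, and lives in `ker (i ^ 0) = 0` anyway.
  exact ⟨fun | 0 => 0 | r + 1 => z r, funext hz⟩

/-- An element `d` of `ker (i ^ (r + 1))` has zero class in `Z^r / im j` exactly when `i ^ r d = 0`.
-/
theorem exact_kerShiftPi {p q p' : ℤ × ℤ} (hp : p + a = p') (hq : q + c = p)
    (h : q + c + a = p') : Function.Exact (C.kerShiftPi hp) (C.kerToCyclePi h) := by
  subst hq
  intro z
  constructor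
  · intro hz
    have hz' : ∀ r, C.iPow r (sub_smul_add_smul h r)
        (z (r + 1) : C.D (p' - (r + 1) • a)) = 0 := fun r => by
      rw [← C.quotK_kerToCycle h]
      exact (congrArg (C.quotK _) (congrFun hz r)).trans (map_zero _)
    refine ⟨fun r => ⟨LinearEquiv.cast (R := R) (M := C.D) (sub_smul_shift hp r).symm (z (r + 1)),
      LinearMap.mem_ker.mpr ?_⟩, funext fun r => ?_⟩
    · exact (C.iPow_cast r _ (sub_smul_add_smul h r) _ _).trans (hz' r)
    · cases r with
      | zero => exact Subsingleton.elim _ _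
      | succ r =>
        refine Subtype.ext ?_
        exact (LinearEquiv.cast (R := R) (M := C.D) (sub_smul_shift hp r)).apply_symm_apply _
  · rintro ⟨z, rfl⟩
    refine funext fun r => C.quotK_injective _ ?_
    refine (C.quotK_kerToCycle h r _).trans ?_
    refine Eq.trans ?_ (map_zero _).symm
    exact (C.iPow_cast r (sub_smul_shift hp r) (sub_add_cancel _ _) _ _).trans
      (LinearMap.mem_ker.mp (z r).2)

theorem kerShiftPi_limDiff {p p' : ℤ × ℤ} (h : p + a = p') (z : ∀ r, C.kerPow p r) :
    C.kerShiftPi h (limDiff _ (C.kerPowMap p) z) =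
      limDiff _ (C.kerPowMap p') (C.kerShiftPi h z) := by
  funext r
  cases r with
  | zero => exact Subsingleton.elim _ _
  | succ r =>
    refine Subtype.ext ?_
    refine (map_sub (LinearEquiv.cast (R := R) (M := C.D) (sub_smul_shift h r)) _ _).trans ?_
    refine congrArg₂ (· - ·) rfl ?_
    exact (C.i_cast (sub_smul_shift h (r + 1)) (sub_smul_shift h r) _ _ _).symm

theorem kerToCyclePi_limDiff {q p' : ℤ × ℤ} (h : q + c + a = p') (z : ∀ r, C.kerPow p' r) :
    C.kerToCyclePi h (limDiff _ (C.kerPowMap p') z) =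
      limDiff _ (C.cycleQuotMap q) (C.kerToCyclePi h z) := by
  funext r
  refine (map_sub (C.kerToCycle h r) _ _).trans (congrArg₂ (· - ·) rfl ?_)
  refine C.quotK_injective _ ?_
  refine (C.quotK_kerToCycle h r _).trans (Eq.trans ?_ (C.quotK_cycleQuotMap q r _).symm)
  refine Eq.trans ?_ (C.quotK_kerToCycle h (r + 1) (z (r + 1 + 1))).symm
  exact (C.iPow_succ_apply r _ _ _ _).symm

/-! ### The kernel filtration as a limit of kernels -/

theorem column_sub_smul {m : ℤ} {p : ℤ × ℤ} (hp : bidet a p = m) (r : ℕ) :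
    bidet a (p - r • a) = m := by
  have h := bidet_add a (p - r • a) (r • a)
  have h' : bidet a (r • a) = 0 := by
    simp only [bidet, Prod.smul_fst, Prod.smul_snd]; ring_nf
  rw [sub_add_cancel, h', add_zero] at h
  rw [← h, hp]

theorem sub_smul_succ_add (p : ℤ × ℤ) (r : ℕ) : p - (r + 1) • a + a = p - r • a := by
  rw [add_smul, one_smul]; abel

theorem nsmul_cancel (ha : a ≠ 0) {r s : ℕ} (h : r • a = s • a) : r = s := by
  by_contra hrs
  refine ha (Prod.ext ?_ ?_)
  · have h₁ := congrArg Prod.fst h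
    rw [Prod.smul_fst, Prod.smul_fst, nsmul_eq_mul, nsmul_eq_mul] at h₁
    exact (mul_eq_mul_right_iff.mp h₁).resolve_left (by exact_mod_cast hrs)
  · have h₂ := congrArg Prod.snd h
    rw [Prod.smul_snd, Prod.smul_snd, nsmul_eq_mul, nsmul_eq_mul] at h₂
    exact (mul_eq_mul_right_iff.mp h₂).resolve_left (by exact_mod_cast hrs)

theorem limAbutment_i {m : ℤ} (f : C.limAbutment m) (y z : Column a m)
    (h : (y : ℤ × ℤ) + a = z) : C.i h (C.limProj y f) = C.limProj z f :=
  f.2 y z h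

theorem limAbutment_iPow {m : ℤ} (f : C.limAbutment m) (r : ℕ) (y z : Column a m)
    (h : (y : ℤ × ℤ) + r • a = z) : C.iPow r h (C.limProj y f) = C.limProj z f := by
  induction r generalizing y with
  | zero =>
    obtain rfl : y = z := Subtype.ext (by simpa using h)
    rfl
  | succ r ih =>
    have h' : (y : ℤ × ℤ) + a + r • a = z := by rw [← h, add_smul, one_smul]; abel
    rw [C.iPow_succ_apply r h rfl h', C.limAbutment_i f y ⟨_, column_add y.2⟩ rfl]
    exact ih ⟨_, column_add y.2⟩ h'

theorem limFiltration_le {m : ℤ} (y z : Column a m) (h : (y : ℤ × ℤ) + a = z) :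
    C.limFiltration y ≤ C.limFiltration z := by
  intro f hf
  refine LinearMap.mem_ker.mpr ?_
  rw [← C.limAbutment_i f y z h, LinearMap.mem_ker.mp hf, map_zero]

/-- The components of an element of `L^p` on the ray `p - r • a`. -/
def filtrationToPi {m : ℤ} {p : ℤ × ℤ} (hp : bidet a p = m) :
    C.limFiltration (⟨p, hp⟩ : Column a m) →ₗ[R] ∀ r, C.kerPow p r :=
  LinearMap.pi fun r =>
    (C.limProj (⟨p - r • a, column_sub_smul hp r⟩ : Column a m)).restrict fun f hf =>
      LinearMap.mem_ker.mpr
        ((C.limAbutment_iPow f r ⟨p - r • a, column_sub_smul hp r⟩ ⟨p, hp⟩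
          (sub_add_cancel p _)).trans (LinearMap.mem_ker.mp hf))

/-- The extension by zero of a family of elements on the ray `p - r • a`. -/
noncomputable def extendRay (p : ℤ × ℤ) (z : ∀ r : ℕ, C.D (p - r • a)) (y : ℤ × ℤ) : C.D y :=
  open Classical in
  if h : ∃ r : ℕ, p - r • a = y then
    LinearEquiv.cast (R := R) (M := C.D) h.choose_spec (z h.choose) else 0

theorem extendRay_apply (ha : a ≠ 0) {p : ℤ × ℤ} (z : ∀ r : ℕ, C.D (p - r • a)) (r : ℕ) :
    C.extendRay p z (p - r • a) = z r := by
  have h : ∃ s : ℕ, p - s • a = p - r • a := ⟨r, rfl⟩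
  have hr : h.choose = r := by
    exact nsmul_cancel ha (sub_right_injective h.choose_spec)
  have key : ∀ (s : ℕ) (hs : p - s • a = p - r • a), s = r →
      LinearEquiv.cast (R := R) (M := C.D) hs (z s) = z r := by
    rintro s hs rfl; rfl
  rw [extendRay, dif_pos h]
  exact key _ _ hr

theorem extendRay_eq_zero {p : ℤ × ℤ} (z : ∀ r : ℕ, C.D (p - r • a)) {y : ℤ × ℤ}
    (hy : ∀ r : ℕ, p - r • a ≠ y) : C.extendRay p z y = 0 :=
  dif_neg fun ⟨r, hr⟩ => hy r hr

/-- Along the ray this is compatibility of `z`; at its end `p` the component is zero, so continuing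
by zero is consistent. -/
theorem i_extendRay (ha : a ≠ 0) {p : ℤ × ℤ} {z : ∀ r, C.kerPow p r}
    (hz : limDiff _ (C.kerPowMap p) z = 0) {y y' : ℤ × ℤ} (h : y + a = y') :
    C.i h (C.extendRay p (fun r => z r) y) = C.extendRay p (fun r => z r) y' := by
  by_cases hy : ∃ r : ℕ, p - r • a = y
  · obtain ⟨r, rfl⟩ := hy
    rw [C.extendRay_apply ha]
    cases r with
    | zero =>
      have h0 : z 0 = 0 := Subsingleton.elim _ _
      rw [h0, extendRay_eq_zero, Submodule.coe_zero, map_zero]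
      intro r hr
      rw [← h] at hr
      -- If `p + a` were again on the ray, a positive multiple of `a` would vanish.
      have h1 : (r + 1) • a = (0 : ℕ) • a := by
        rw [zero_smul, sub_zero] at hr
        rw [add_smul, one_smul, zero_smul, ← sub_eq_zero.mpr hr.symm]
        abel
      exact absurd (nsmul_cancel ha h1) r.succ_ne_zero
    | succ r =>
      obtain rfl : y' = p - r • a := by rw [← h, add_smul, one_smul]; abel
      rw [C.extendRay_apply ha]
      have hr : z r = C.kerPowMap p r (z (r + 1)) := sub_eq_zero.mp (congrFun hz r)
      rw [hr]
      rfl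
  · push Not at hy
    rw [C.extendRay_eq_zero _ hy, map_zero]
    by_cases hy' : ∃ r : ℕ, p - r • a = y'
    · obtain ⟨r, rfl⟩ := hy'
      -- A predecessor of a ray point is a ray point, so `i` cannot enter the ray from outside.
      refine absurd ?_ (hy (r + 1))
      rw [eq_sub_of_add_eq h, add_smul, one_smul]; abel
    · push Not at hy'
      rw [C.extendRay_eq_zero _ hy']

theorem exact_filtrationToPi (ha : a ≠ 0) {m : ℤ} {p : ℤ × ℤ} (hp : bidet a p = m) :
    Function.Exact (C.filtrationToPi hp) (limDiff _ (C.kerPowMap p)) := by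
  intro z
  constructor
  · intro hz
    have h0 : C.extendRay p (fun r => z r) p = 0 := by
      by_cases h : ∃ r : ℕ, p - r • a = p
      · have e := C.extendRay_apply ha (fun r => (z r : C.D (p - r • a))) 0
        have hz0 : z 0 = 0 := Subsingleton.elim _ _
        -- The points `p - 0 • a` and `p` agree only propositionally, so the vanishing has to be
        -- transported.
        have key : ∀ y, y = p → C.extendRay p (fun r => z r) y = 0 →
          C.extendRay p (fun r => z r) p = 0 := by rintro _ rfl h; exact h
        exact key (p - 0 • a) (by simp) (e.trans (congrArg Subtype.val hz0))
      · push Not at h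
        exact C.extendRay_eq_zero _ h
    refine ⟨⟨⟨fun y => C.extendRay p (fun r => z r) y, fun y y' h => C.i_extendRay ha hz h⟩, h0⟩,
      funext fun r => Subtype.ext ?_⟩
    exact C.extendRay_apply ha (fun r => (z r : C.D (p - r • a))) r
  · rintro ⟨f, rfl⟩
    refine funext fun r => sub_eq_zero.mpr (Subtype.ext ?_)
    exact (C.limAbutment_i f.1 ⟨p - (r + 1) • a, column_sub_smul hp _⟩
      ⟨p - r • a, column_sub_smul hp r⟩ (sub_smul_succ_add p r)).symm

/-! ### The six-term sequence -/

/-- The inclusion of filtration stages `L^p → L^(p + a)`. -/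
def filtrationIncl {m : ℤ} {p p' : ℤ × ℤ} (hp : bidet a p = m) (hp' : bidet a p' = m)
    (h : p + a = p') :
    C.limFiltration (⟨p, hp⟩ : Column a m) →ₗ[R] C.limFiltration (⟨p', hp'⟩ : Column a m) :=
  Submodule.inclusion (C.limFiltration_le _ _ h)

/-- The component at `q + c` dies under `i`, hence is `k e`. The earlier components of `f` are
preimages of it under every `i ^ r`, so `e ∈ Z^∞`. -/
theorem limProj_mem_range_quotK {m : ℤ} {q p' : ℤ × ℤ} (hq : bidet a (q + c) = m)
    (hp' : bidet a p' = m) (h : q + c + a = p')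
    (f : C.limFiltration (⟨p', hp'⟩ : Column a m)) :
    C.limProj (⟨q + c, hq⟩ : Column a m) f.1 ∈ LinearMap.range (C.quotK (C.cyclesInf q)) := by
  obtain ⟨e, he⟩ := (C.exact_ki rfl h _).mp
    ((C.limAbutment_i f.1 ⟨q + c, hq⟩ ⟨p', hp'⟩ h).trans (LinearMap.mem_ker.mp f.2))
  rw [← he]
  refine C.mem_range_quotK _ e ((Submodule.mem_iInf _).mpr fun r => ?_)
  refine ⟨C.limProj (⟨q + c - r • a, column_sub_smul hq r⟩ : Column a m) f.1, ?_⟩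
  exact (C.limAbutment_iPow f.1 r ⟨q + c - r • a, column_sub_smul hq r⟩ ⟨q + c, hq⟩
    (sub_add_cancel _ _)).trans he.symm

/-- The map `L^(q + c + a) → Z^∞ / im j` with `f ↦ [e]` for `k e` the component of `f` in
`D (q + c)`. -/
noncomputable def filtrationToCycle {m : ℤ} {q p' : ℤ × ℤ} (hq : bidet a (q + c) = m)
    (hp' : bidet a p' = m) (h : q + c + a = p') :
    C.limFiltration (⟨p', hp'⟩ : Column a m) →ₗ[R] C.CycleQuotInf q :=
  liftInjective (M := C.limFiltration (⟨p', hp'⟩ : Column a m)) (N := C.CycleQuotInf q)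
    (C.quotK (C.cyclesInf q)) (C.quotK_injective _)
    (C.limProj (⟨q + c, hq⟩ : Column a m) ∘ₗ (C.limFiltration (⟨p', hp'⟩ : Column a m)).subtype)
    (C.limProj_mem_range_quotK hq hp' h)

theorem quotK_filtrationToCycle {m : ℤ} {q p' : ℤ × ℤ} (hq : bidet a (q + c) = m)
    (hp' : bidet a p' = m) (h : q + c + a = p')
    (f : C.limFiltration (⟨p', hp'⟩ : Column a m)) :
    C.quotK _ (C.filtrationToCycle hq hp' h f) = C.limProj (⟨q + c, hq⟩ : Column a m) f.1 :=
  apply_liftInjective (M := C.limFiltration (⟨p', hp'⟩ : Column a m)) (N := C.CycleQuotInf q)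
    (C.quotK (C.cyclesInf q)) (C.quotK_injective _) _ (C.limProj_mem_range_quotK hq hp' h) f

theorem filtrationToCycle_eq_mk {m : ℤ} {q p' : ℤ × ℤ} (hq : bidet a (q + c) = m)
    (hp' : bidet a p' = m) (h : q + c + a = p')
    (f : C.limFiltration (⟨p', hp'⟩ : Column a m)) (e : C.cyclesInf q)
    (he : C.k rfl (e : C.E q) = C.limProj (⟨q + c, hq⟩ : Column a m) f.1) :
    C.filtrationToCycle hq hp' h f = Submodule.Quotient.mk e :=
  C.quotK_injective (C.cyclesInf q) ((C.quotK_filtrationToCycle hq hp' h f).trans he.symm)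

theorem exact_filtrationIncl {m : ℤ} {p q p' : ℤ × ℤ} (hp : bidet a p = m)
    (hq : bidet a (q + c) = m) (hp' : bidet a p' = m) (h : p + a = p') (h' : q + c + a = p') :
    Function.Exact (C.filtrationIncl hp hp' h) (C.filtrationToCycle hq hp' h') := by
  obtain rfl : p = q + c := add_right_cancel (h.trans h'.symm)
  intro f
  constructor
  · intro hf
    refine ⟨⟨f.1, LinearMap.mem_ker.mpr ?_⟩, rfl⟩
    rw [← C.quotK_filtrationToCycle hq hp' h', hf, map_zero]
  · rintro ⟨f, rfl⟩
    refine C.quotK_injective _ ?_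
    rw [quotK_filtrationToCycle, map_zero]
    exact f.2

theorem kerToCyclePi_filtrationToPi {m : ℤ} {q p' : ℤ × ℤ} (hq : bidet a (q + c) = m)
    (hp' : bidet a p' = m) (h : q + c + a = p')
    (f : C.limFiltration (⟨p', hp'⟩ : Column a m)) :
    C.kerToCyclePi h (C.filtrationToPi hp' f) =
      C.cycleQuotInfToPi q (C.filtrationToCycle hq hp' h f) := by
  refine funext fun r => C.quotK_injective _ ?_
  rw [quotK_cycleQuotInfToPi, quotK_filtrationToCycle]
  exact (C.quotK_kerToCycle h r _).trans
    (C.limAbutment_iPow f.1 r ⟨p' - (r + 1) • a, column_sub_smul hp' _⟩ ⟨q + c, hq⟩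
      (sub_smul_add_smul h r))

/-- The map `lim¹ ker (i ^ r) → lim¹ ker (i ^ (r + 1)) = lim¹ ker (i ^ r)`. -/
def limOneKerIncl {p p' : ℤ × ℤ} (h : p + a = p') : C.LimOneKer p →ₗ[R] C.LimOneKer p' :=
  Submodule.mapQ _ _ (C.kerShiftPi h) (range_le_comap_range (C.kerShiftPi_limDiff h))

/-- The map `lim¹ ker (i ^ (r + 1)) → lim¹ (Z^r / im j)`. -/
noncomputable def limOneKerToCycle {q p' : ℤ × ℤ} (h : q + c + a = p') :
    C.LimOneKer p' →ₗ[R] C.LimOneCycleQuot q :=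
  Submodule.mapQ _ _ (C.kerToCyclePi h) (range_le_comap_range (C.kerToCyclePi_limDiff h))

theorem limOneKerToCycle_surjective {q p' : ℤ × ℤ} (h : q + c + a = p') :
    Function.Surjective (C.limOneKerToCycle h) := by
  intro m
  obtain ⟨m, rfl⟩ := Submodule.Quotient.mk_surjective _ m
  obtain ⟨z, rfl⟩ := C.kerToCyclePi_surjective h m
  exact ⟨Submodule.Quotient.mk z, rfl⟩

theorem exact_limOneKerIncl {p q p' : ℤ × ℤ} (h : p + a = p') (h' : q + c + a = p') :
    Function.Exact (C.limOneKerIncl h) (C.limOneKerToCycle h') :=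
  exact_mapQ_range (C.exact_kerShiftPi h (add_right_cancel (h'.trans h.symm)) h')
    (C.kerToCyclePi_surjective h') (C.kerShiftPi_limDiff h) (C.kerToCyclePi_limDiff h')

/-- The target is fixed as `p + a` so that a single choice of `δ`, depending only on `q` and `p`,
carries the formula and both exactness statements. -/
theorem exists_cycleToLimOneKer (ha : a ≠ 0) {q p : ℤ × ℤ} (h : q + c = p) :
    ∃ δ : C.CycleQuotInf q →ₗ[R] C.LimOneKer p,
      (∀ (x : C.CycleQuotInf q) (y : ∀ r, C.kerPow (p + a) r) (z : ∀ r, C.kerPow p r),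
        C.kerToCyclePi (congrArg (· + a) h) y = C.cycleQuotInfToPi q x →
        C.kerShiftPi rfl z = limDiff (fun r => C.kerPow (p + a) r) (C.kerPowMap (p + a)) y →
        δ x = C.limOneKerMk p z) ∧
      Function.Exact (C.filtrationToCycle (m := bidet a p) (q := q) (p' := p + a)
        (congrArg (bidet a) h) (column_add rfl) (congrArg (· + a) h)) δ ∧
      Function.Exact δ (C.limOneKerIncl (p := p) (p' := p + a) rfl) := by
  have h' : q + c + a = p + a := congrArg (· + a) h
  have hp' : bidet a (p + a) = bidet a p := column_add rfl
  obtain ⟨δ, h₁, h₂, h₃⟩ := exists_connecting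
    (K₂ := C.limFiltration (⟨p + a, hp'⟩ : Column a (bidet a p))) (K₃ := C.CycleQuotInf q)
    (M₁ := ∀ r, C.kerPow p r) (M₂ := ∀ r, C.kerPow (p + a) r) (M₃ := ∀ r, C.CycleQuot q r)
    (f₁ := C.kerShiftPi (rfl : p + a = p + a))
    (f₂ := C.kerToCyclePi h') (d₁ := limDiff (fun r => C.kerPow p r) (C.kerPowMap p))
    (d₂ := limDiff (fun r => C.kerPow (p + a) r) (C.kerPowMap (p + a)))
    (d₃ := limDiff (C.CycleQuot q) (C.cycleQuotMap q))
    (s₂ := C.filtrationToPi hp') (s₃ := C.cycleQuotInfToPi q)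
    (F := C.filtrationToCycle (congrArg (bidet a) h) hp' h')
    (C.kerShiftPi_injective rfl) (C.exact_kerShiftPi rfl h h') (C.kerToCyclePi_surjective h')
    (C.kerShiftPi_limDiff rfl) (C.kerToCyclePi_limDiff h')
    (C.exact_filtrationToPi ha hp') (C.exact_cycleQuotInfToPi q) (C.cycleQuotInfToPi_injective q)
    (fun f => C.kerToCyclePi_filtrationToPi (congrArg (bidet a) h) hp' h' f)
  refine ⟨δ, ?_, ?_, ?_⟩
  · intro x y z hy hz
    exact h₁ x y z hy hz
  · exact h₂
  · exact h₃

/-- The connecting homomorphism `Z^∞ / im j → lim¹ ker (i ^ r)`. -/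
noncomputable def cycleToLimOneKer (ha : a ≠ 0) {q p : ℤ × ℤ} (h : q + c = p) :
    C.CycleQuotInf q →ₗ[R] C.LimOneKer p :=
  (C.exists_cycleToLimOneKer ha h).choose

theorem exact_filtrationToCycle (ha : a ≠ 0) {m : ℤ} {q p p' : ℤ × ℤ}
    (hq : bidet a (q + c) = m) (hp' : bidet a p' = m) (h : q + c = p) (h' : q + c + a = p') :
    Function.Exact (C.filtrationToCycle hq hp' h') (C.cycleToLimOneKer ha h) := by
  subst h; subst h'; subst hq
  exact (C.exists_cycleToLimOneKer ha rfl).choose_spec.2.1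

theorem exact_cycleToLimOneKer (ha : a ≠ 0) {q p p' : ℤ × ℤ} (h : q + c = p) (h' : p + a = p') :
    Function.Exact (C.cycleToLimOneKer ha h) (C.limOneKerIncl h') := by
  subst h'
  exact (C.exists_cycleToLimOneKer ha h).choose_spec.2.2

theorem cycleToLimOneKer_mk (ha : a ≠ 0) {q p : ℤ × ℤ} (h : q + c = p) (e : C.cyclesInf q)
    (w : ∀ r : ℕ, C.D (p - r • a)) (z : ∀ r : ℕ, C.kerPow p r)
    (hw : ∀ r, C.iPow r (sub_add_cancel p (r • a)) (w r) = C.k h (e : C.E q))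
    (hz : ∀ r, (z r : C.D (p - r • a)) = w r -
      C.i (show p - (r + 1) • a + a = p - r • a by rw [add_smul, one_smul]; abel) (w (r + 1))) :
    C.cycleToLimOneKer ha h (Submodule.Quotient.mk e) = C.limOneKerMk p z := by
  subst h
  have hc : ∀ r, C.iPow r (sub_smul_add_smul rfl r)
      (LinearEquiv.cast (R := R) (M := C.D) (sub_smul_shift rfl r) (w r)) =
        C.k rfl (e : C.E q) := fun r => by
    rw [C.iPow_cast r _ (sub_add_cancel _ _), hw]
  have mem : ∀ r, LinearEquiv.cast (R := R) (M := C.D) (sub_smul_shift rfl r) (w r) ∈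
      C.kerPow (q + c + a) (r + 1) := fun r => by
    refine LinearMap.mem_ker.mpr ?_
    rw [← C.i_iPow r (sub_smul_add_smul rfl r) rfl, hc, (C.exact_ki rfl rfl).apply_apply_eq_zero]
  -- The snake lift of `[e]` is `w` moved up by one index, with `0` in front; its `limDiff` in
  -- component `r + 1` is `w r - i (w (r + 1))`, which is `z r`.
  refine (C.exists_cycleToLimOneKer ha rfl).choose_spec.1 _
    (fun | 0 => 0 | r + 1 => ⟨_, mem r⟩) z ?_ ?_
  · refine funext fun r => C.quotK_injective _ ?_
    rw [quotK_cycleQuotInfToPi, quotK_mk]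
    exact (C.quotK_kerToCycle rfl r _).trans (hc r)
  · refine funext fun r => ?_
    cases r with
    | zero => exact Subsingleton.elim _ _
    | succ r =>
      refine Subtype.ext ?_
      refine (congrArg (LinearEquiv.cast (R := R) (M := C.D) (sub_smul_shift rfl r)) (hz r)).trans ?_
      refine (map_sub _ _ _).trans (congrArg₂ (· - ·) rfl ?_)
      exact (C.i_cast (sub_smul_shift rfl (r + 1)) (sub_smul_shift rfl r) _ _ _).symm

theorem limOneKerIncl_mk {p p' : ℤ × ℤ} (h : p + a = p') (z : ∀ r : ℕ, C.kerPow p r)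
    (z' : ∀ r : ℕ, C.kerPow p' r)
    (hz : ∀ r, (z' (r + 1) : C.D (p' - (r + 1) • a)) =
      LinearEquiv.cast (R := R) (M := C.D) (sub_smul_shift h r) (z r : C.D (p - r • a))) :
    C.limOneKerIncl h (C.limOneKerMk p z) = C.limOneKerMk p' z' := by
  refine congrArg (Submodule.Quotient.mk) (funext fun r => ?_)
  cases r with
  | zero => exact Subsingleton.elim _ _
  | succ r => exact Subtype.ext (hz r).symm

theorem limOneKerToCycle_mk {q p' : ℤ × ℤ} (h : q + c + a = p') (z : ∀ r : ℕ, C.kerPow p' r)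
    (e : ∀ r : ℕ, C.cycles r q)
    (he : ∀ r, C.k rfl (e r : C.E q) = C.iPow r (sub_smul_add_smul h r)
      (z (r + 1) : C.D (p' - (r + 1) • a))) :
    C.limOneKerToCycle h (C.limOneKerMk p' z) = C.limOneCycleMk q e := by
  refine congrArg (Submodule.Quotient.mk) (funext fun r => C.quotK_injective _ ?_)
  exact (C.quotK_kerToCycle h r _).trans (he r).symm

theorem cast_limOneKerToCycle {q q' p' : ℤ × ℤ} (hq : q = q') (h : q + c + a = p')
    (h' : q' + c + a = p') (z : C.LimOneKer p') :
    LinearEquiv.cast (R := R) (M := C.LimOneCycleQuot) hq (C.limOneKerToCycle h z) =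
      C.limOneKerToCycle h' z := by
  subst hq; rfl

end ExactCouple

/-! ### Exactness for direct sums of two columns joined by a connecting map -/

section ExactProducts

variable {R : Type u} [Ring R] {M₁ M₂ M₃ N₁ N₂ N₃ : Type*} [AddCommMonoid M₁] [AddCommMonoid M₂]
  [AddCommMonoid M₃] [AddCommMonoid N₁] [AddCommMonoid N₂] [AddCommMonoid N₃] [Module R M₁]
  [Module R M₂] [Module R M₃] [Module R N₁] [Module R N₂] [Module R N₃]

theorem exact_prodMap {f : M₁ →ₗ[R] M₂} {g : M₂ →ₗ[R] M₃} {f' : N₁ →ₗ[R] N₂} {g' : N₂ →ₗ[R] N₃}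
    (h : Function.Exact f g) (h' : Function.Exact f' g') :
    Function.Exact (f.prodMap f') (g.prodMap g') := by
  rintro ⟨y, y'⟩
  constructor
  · intro hy
    obtain ⟨x, hx⟩ := (h y).mp (congrArg Prod.fst hy)
    obtain ⟨x', hx'⟩ := (h' y').mp (congrArg Prod.snd hy)
    exact ⟨(x, x'), Prod.ext hx hx'⟩
  · rintro ⟨⟨x, x'⟩, hx⟩
    exact Prod.ext ((h y).mpr ⟨x, congrArg Prod.fst hx⟩) ((h' y').mpr ⟨x', congrArg Prod.snd hx⟩)

/-- The connecting map kills the second summand, so exactness there is the surjectivity at the right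
end of the six-term sequence. -/
theorem exact_prodMap_inr_fst {f : M₁ →ₗ[R] M₂} {f' : N₁ →ₗ[R] N₂} {k : M₂ →ₗ[R] N₃}
    (h : Function.Exact f k) (hf' : Function.Surjective f') :
    Function.Exact (f.prodMap f') (LinearMap.inr R M₃ N₃ ∘ₗ k ∘ₗ LinearMap.fst R M₂ N₂) := by
  rintro ⟨y, y'⟩
  constructor
  · intro hy
    obtain ⟨x, hx⟩ := (h y).mp (congrArg Prod.snd hy)
    obtain ⟨x', hx'⟩ := hf' y'
    exact ⟨(x, x'), Prod.ext hx hx'⟩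
  · rintro ⟨⟨x, x'⟩, hx⟩
    exact Prod.ext rfl ((h y).mpr ⟨x, congrArg Prod.fst hx⟩)

/-- The connecting map misses the first summand, so exactness there is the injectivity at the left
end of the six-term sequence. -/
theorem exact_inr_fst_prodMap {k : M₁ →ₗ[R] N₂} {g : M₂ →ₗ[R] M₃} {g' : N₂ →ₗ[R] N₃}
    (h : Function.Exact k g') (hg : Function.Injective g) :
    Function.Exact (LinearMap.inr R M₂ N₂ ∘ₗ k ∘ₗ LinearMap.fst R M₁ N₁) (g.prodMap g') := by
  rintro ⟨y, y'⟩
  constructor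
  · intro hy
    obtain ⟨x, hx⟩ := (h y').mp (congrArg Prod.snd hy)
    exact ⟨(x, 0), Prod.ext (hg ((map_zero g).trans (congrArg Prod.fst hy).symm)) hx⟩
  · rintro ⟨⟨x, x'⟩, hx⟩
    have hy : 0 = y := congrArg Prod.fst hx
    exact Prod.ext ((congrArg g hy.symm).trans (map_zero g)) ((h y').mpr ⟨x, congrArg Prod.snd hx⟩)

end ExactProducts

namespace ExactCouple

variable {R : Type u} [Ring R] {a b c : ℤ × ℤ} (C : ExactCouple.{u, v} R a b c)

/-! ### Assembling the lim-1 exact couple -/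

theorem bidet_of_add_self {x y : ℤ × ℤ} (h : x + a = y) : bidet a y = bidet a x := by
  rw [← h, bidet_add, bidet_self, add_zero]

theorem bidet_sub_of_add {x z : ℤ × ℤ} (h : x + b = z) : bidet a (z - b) = bidet a x := by
  rw [← h, add_sub_cancel_right]

/-- With `E`-positions indexed by the column of `z - b`, this is the jump by `σ` that makes `k` pass
from column `n` to column `n + σ`. -/
theorem bidet_of_add {y z : ℤ × ℤ} (h : z + c = y) :
    bidet a y = bidet a (z - b) + bidet a (b + c) := by
  rw [← bidet_add, ← h]; congr 1; abel

/-- The `D`-objects of the lim-1 exact couple: `L^(y + a + b + c)` in column `n`, and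
`lim¹ ker (i ^ r)` in column `n + σ`. -/
abbrev LimOneD (n : ℤ) (y : ℤ × ℤ) : Type v :=
  (∀ h : PLift (bidet a y = n), C.limFiltration
    (⟨y + a + b + c, column_next b c (column_add h.down)⟩ : Column a (n + bidet a (b + c)))) ×
  (∀ _ : PLift (bidet a y = n + bidet a (b + c)), C.LimOneKer y)

/-- The `E`-objects of the lim-1 exact couple: `Z^∞ / im j` for `z - b` in column `n`, and
`lim¹ (Z^r / im j)` for `z - b` in column `n + σ`. -/
abbrev LimOneE (n : ℤ) (z : ℤ × ℤ) : Type v :=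
  (∀ _ : PLift (bidet a (z - b) = n), C.CycleQuotInf z) ×
  (∀ _ : PLift (bidet a (z - b) = n + bidet a (b + c)), C.LimOneCycleQuot (z - a - b - c))

/-- The maps `i` of the lim-1 exact couple. -/
def limOneI (n : ℤ) {x y : ℤ × ℤ} (h : x + a = y) : C.LimOneD n x →ₗ[R] C.LimOneD n y :=
  LinearMap.prodMap
    (propMap (fun hy => (bidet_of_add_self h).symm.trans hy) fun _ =>
      C.filtrationIncl (p := x + a + b + c) (p' := y + a + b + c) _ _ (by rw [← h]; abel))
    (propMap (fun hy => (bidet_of_add_self h).symm.trans hy) fun _ => C.limOneKerIncl h)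

/-- The maps `j` of the lim-1 exact couple. -/
noncomputable def limOneJ (n : ℤ) {x z : ℤ × ℤ} (h : x + b = z) :
    C.LimOneD n x →ₗ[R] C.LimOneE n z :=
  LinearMap.prodMap
    (propMap (fun hz => (bidet_sub_of_add h).symm.trans hz) fun hz =>
      C.filtrationToCycle (q := z) (p' := x + a + b + c)
        ((bidet_of_add rfl).trans (congrArg (· + _) hz.down)) _
        (by rw [← h]; abel))
    (propMap (fun hz => (bidet_sub_of_add h).symm.trans hz) fun _ =>
      C.limOneKerToCycle (q := z - a - b - c) (p' := x) (by rw [← h]; abel))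

/-- The maps `k` of the lim-1 exact couple. -/
noncomputable def limOneK (ha : a ≠ 0) (n : ℤ) {z y : ℤ × ℤ} (h : z + c = y) :
    C.LimOneE n z →ₗ[R] C.LimOneD n y :=
  LinearMap.inr R _ _ ∘ₗ
    (propMap (fun hy => add_right_cancel ((bidet_of_add h).symm.trans hy)) fun _ =>
      C.cycleToLimOneKer ha h) ∘ₗ
    LinearMap.fst R _ _

theorem exact_limOneI_limOneJ (n : ℤ) {x y z : ℤ × ℤ} (h : x + a = y) (h' : y + b = z) :
    Function.Exact (C.limOneI n h) (C.limOneJ n h') := by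
  refine exact_prodMap (propMap_exact _ (fun hx => (bidet_of_add_self h).trans hx) _
    (fun hy => (bidet_sub_of_add h').trans hy) fun _ => ?_)
    (propMap_exact _ (fun hx => (bidet_of_add_self h).trans hx) _
    (fun hy => (bidet_sub_of_add h').trans hy) fun _ => ?_)
  · exact C.exact_filtrationIncl _ _ _ _ _
  · exact C.exact_limOneKerIncl _ _

theorem exact_limOneJ_limOneK (ha : a ≠ 0) (n : ℤ) {x z y : ℤ × ℤ} (h : x + b = z)
    (h' : z + c = y) : Function.Exact (C.limOneJ n h) (C.limOneK ha n h') := by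
  refine exact_prodMap_inr_fst (propMap_exact _ (fun hx => (bidet_sub_of_add h).trans hx) _
    (fun hz => (bidet_of_add h').trans (congrArg (· + _) hz)) fun _ => ?_)
    (propMap_surjective _ (fun hx => (bidet_sub_of_add h).trans hx) fun _ => ?_)
  · exact C.exact_filtrationToCycle ha _ _ _ _
  · exact C.limOneKerToCycle_surjective _

theorem exact_limOneK_limOneI (ha : a ≠ 0) (n : ℤ) {z y w : ℤ × ℤ} (h : z + c = y)
    (h' : y + a = w) : Function.Exact (C.limOneK ha n h) (C.limOneI n h') := by
  refine exact_inr_fst_prodMap (propMap_exact _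
    (fun hz => (bidet_of_add h).trans (congrArg (· + _) hz)) _
    (fun hy => (bidet_of_add_self h').trans hy) fun _ => ?_)
    (propMap_injective _ (fun hy => (bidet_of_add_self h').trans hy) fun _ => ?_)
  · exact C.exact_cycleToLimOneKer ha _ _
  · exact Submodule.inclusion_injective _

/-- The lim-1 exact couple. -/
noncomputable def limOneExactCouple (C : ExactCouple.{u, v} R a b c) (ha : a ≠ 0) (n : ℤ) :
    ExactCouple.{u, v} R a b c where
  D := C.LimOneD n
  E := C.LimOneE n
  addCommGroupE _ := Prod.instAddCommGroup
  moduleE _ := Prod.instModule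
  i h := C.limOneI n h
  j h := C.limOneJ n h
  k h := C.limOneK ha n h
  exact_ij h h' := C.exact_limOneI_limOneJ n h h'
  exact_jk h h' := C.exact_limOneJ_limOneK ha n h h'
  exact_ki h h' := C.exact_limOneK_limOneI ha n h h'

/-- The identification of the objects and maps of the lim-1 exact couple. -/
noncomputable def limOneCoupleData (ha : a ≠ 0) (hσ : bidet a (b + c) ≠ 0) (n : ℤ) :
    C.LimOneCouple n (C.limOneExactCouple ha n) where
  isoD {x} hx := propProdLeft _ _ hx (by rw [hx]; simpa using hσ)
  isoD₁ {x} hx := propProdRight _ _ (by rw [column_next b c hx]; simpa using hσ)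
    (column_next b c hx)
  isoE {x} hx := propProdLeft _ _ (by rw [add_sub_cancel_right, hx])
    (by rw [add_sub_cancel_right, hx]; simpa using hσ)
  isoE₁ {x} hx :=
    have h : bidet a (x + 2 • b + c - b) = n + bidet a (b + c) := by
      rw [← column_next b c hx, two_smul]; congr 1; abel
    (propProdRight _ _ (by rw [h]; simpa using hσ) h).trans
      (LinearEquiv.cast (R := R) (M := C.LimOneCycleQuot) (by rw [two_smul]; abel))
  zeroD y hy hy' := subsingleton_propProd _ _ hy hy'
  zeroE y hy hy' := subsingleton_propProd _ _ (by rwa [add_sub_cancel_right])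
    (by rwa [add_sub_cancel_right])
  map_i hx d := rfl
  map_j {x} hx d e he := C.filtrationToCycle_eq_mk (column_next b c hx)
    (column_next b c (column_add hx)) (by abel) (Prod.fst d ⟨hx⟩) e he
  map_k hx e w z hw hz := C.cycleToLimOneKer_mk ha rfl e w z hw hz
  map_i₁ hx z z' hz := C.limOneKerIncl_mk _ z z' hz
  map_j₁ {x} hx z e he := by
    have h : x - a + b + c + a = x + b + c := by abel
    have hq : x + 2 • b + c - a - b - c = x - a + b := by rw [two_smul]; abel
    have h' : x + 2 • b + c - a - b - c + c + a = x + b + c := by rw [hq, h]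
    have key := (C.cast_limOneKerToCycle hq h' h (C.limOneKerMk (x + b + c) z)).trans
      (C.limOneKerToCycle_mk h z e he)
    -- The cast in `isoE₁` compares two expressions for the position `x - a + b`; `key` moves it
    -- past the map to `lim¹` of the cycles.
    refine Eq.trans ?_ key
    rfl

end ExactCouple

/-- For every regular exact couple `C` and every integer `n` there is a regular exact couple
with structure maps of the same bidegrees that is the lim-1 exact couple of `C` in position `n`. -/
theorem mainTheorem12 {R : Type u} [Ring R] {a b c : ℤ × ℤ} (C : ExactCouple.{u, v} R a b c)
    (hC : C.IsRegular) (n : ℤ) :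
    ∃ C' : ExactCouple.{u, v} R a b c, C'.IsRegular ∧ Nonempty (C.LimOneCouple n C') := by
  have hσ : bidet a (b + c) ≠ 0 := by rcases hC with h | h <;> rw [h] <;> decide
  have ha : a ≠ 0 := by
    rintro rfl
    exact hσ (by simp [bidet])
  exact ⟨C.limOneExactCouple ha n, hC, ⟨C.limOneCoupleData ha hσ n⟩⟩
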